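/- Let $E$ and $F$ be Banach spaces over the same scalar field $\mathbb{K}$, where $\mathbb{K}=\mathbb{R}$ or $\mathbb{K}=\mathbb{C}$. A series $\sum_i x_i$ in $E$ is called weakly unconditionally Cauchy if $\sum_i |\varphi(x_i)|<\infty$ for every continuous linear functional $\varphi\in E^*$. A series in $F$ is called unconditionally convergent if each of its subseries converges in norm. A map $P:E\to F$ is called unconditionally converging if, for every weakly unconditionally Cauchy series $\sum_i x_i$ in $E$, the series $\sum_i P(x_i)$ is unconditionally convergent in $F$. For an integer $k\ge 1$, a (continuous) $k$-homogeneous polynomial $P:E\to F$ is a map of the form $P(x)=A(x,\dots,x)$ for some continuous $k$-linear map $A:E^k\to F$. If every bounded linear operator $E\to F$ is unconditionally converging, then for every integer $k\ge 1$ every continuous $k$-homogeneous polynomial $E\to F$ is unconditionally converging. -/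

import Mathlib

open Filter Topology

/-- The formal series `∑ x i` is weakly unconditionally Cauchy: `∑ |φ (x i)| < ∞` for every
continuous linear functional `φ`. -/
def WeaklyUnconditionallyCauchy (𝕜 : Type*) {E : Type*} [RCLike 𝕜] [NormedAddCommGroup E]
    [NormedSpace 𝕜 E] (x : ℕ → E) : Prop :=
  ∀ φ : E →L[𝕜] 𝕜, Summable fun i => ‖φ (x i)‖

/-- The series `∑ y i` is unconditionally convergent: every subseries converges in norm. -/
def UnconditionallyConvergent {F : Type*} [NormedAddCommGroup F] (y : ℕ → F) : Prop :=
  ∀ σ : ℕ → ℕ, StrictMono σ →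
    ∃ s : F, Tendsto (fun n => ∑ i ∈ Finset.range n, y (σ i)) atTop (𝓝 s)

/-- A map is unconditionally converging if it takes weakly unconditionally Cauchy series into
unconditionally convergent series. -/
def UnconditionallyConverging (𝕜 : Type*) {E F : Type*} [RCLike 𝕜] [NormedAddCommGroup E]
    [NormedSpace 𝕜 E] [NormedAddCommGroup F] (P : E → F) : Prop :=
  ∀ x : ℕ → E, WeaklyUnconditionallyCauchy 𝕜 x → UnconditionallyConvergent fun i => P (x i)

/-- `P` is a continuous `k`-homogeneous polynomial: the restriction to the diagonal of a
continuous `k`-linear map. -/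
def IsHomogeneousPolynomial (𝕜 : Type*) {E F : Type*} [RCLike 𝕜] [NormedAddCommGroup E]
    [NormedSpace 𝕜 E] [NormedAddCommGroup F] [NormedSpace 𝕜 F] (k : ℕ) (P : E → F) : Prop :=
  ∃ A : ContinuousMultilinearMap 𝕜 (fun _ : Fin k => E) F, ∀ x : E, P x = A fun _ => x

/-! If `∑ P (x i)` is not summable, there are disjoint finite blocks on which its sums have norm at
least `δ`. Choosing signs separately in each slot bounds every block sum by one value of `A` at
signed block sums of `x` (`exists_signs_norm_sum_apply_le`). Those block sums are again weakly
unconditionally Cauchy, so it suffices that `A` tends to zero along such sequences. This goes by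
induction on the number of slots: freezing the first argument gives operators `V n` tending
pointwise to zero. If `y n = V n (u n)` stayed large, then for norming functionals `φ j` of `y j`,
Rosenthal's lemma would make `T v = ∑ φ j (V j v) • y j` nearly diagonal on a subsequence, so `T (u
n)` would not tend to zero, against the hypothesis on operators. -/

/-- All finite combinations of the terms of `x` with coefficients in the unit ball have norm at
most `M`. -/
def UnconditionallyBounded (𝕜 : Type*) {E : Type*} [RCLike 𝕜] [NormedAddCommGroup E]
    [NormedSpace 𝕜 E] (x : ℕ → E) (M : ℝ) : Prop :=
  ∀ (S : Finset ℕ) (c : ℕ → 𝕜), (∀ i, ‖c i‖ ≤ 1) → ‖∑ i ∈ S, c i • x i‖ ≤ M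

/-! ### Unconditionally bounded sequences -/

section

variable {𝕜 E F : Type*} [RCLike 𝕜] [NormedAddCommGroup E] [NormedSpace 𝕜 E]
  [NormedAddCommGroup F] [NormedSpace 𝕜 F]

/-- Uniform boundedness on the dual: finite combinations, viewed as functionals of `φ`, are bounded
pointwise by `∑ ‖φ (x i)‖`. Hahn–Banach brings the bound back to `E`. -/
theorem WeaklyUnconditionallyCauchy.exists_unconditionallyBounded {x : ℕ → E}
    (hx : WeaklyUnconditionallyCauchy 𝕜 x) : ∃ M, UnconditionallyBounded 𝕜 x M := by
  let ι := Finset ℕ × {c : ℕ → 𝕜 // ∀ i, ‖c i‖ ≤ 1}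
  let g : ι → (E →L[𝕜] 𝕜) →L[𝕜] 𝕜 := fun p =>
    ContinuousLinearMap.apply 𝕜 𝕜 (∑ i ∈ p.1, p.2.1 i • x i)
  obtain ⟨M, hM⟩ := banach_steinhaus (g := g) (fun φ => ⟨∑' i, ‖φ (x i)‖, fun p => by
    calc ‖g p φ‖ = ‖∑ i ∈ p.1, p.2.1 i * φ (x i)‖ := by simp [g]
      _ ≤ ∑ i ∈ p.1, ‖φ (x i)‖ := norm_sum_le_of_le _ fun i _ => by
          rw [norm_mul]
          exact mul_le_of_le_one_left (norm_nonneg _) (p.2.2 i)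
      _ ≤ _ := (hx φ).sum_le_tsum _ fun _ _ => norm_nonneg _⟩)
  refine ⟨M, fun S c hc => ?_⟩
  have hM0 : 0 ≤ M := (norm_nonneg _).trans (hM ⟨∅, 0, by simp⟩)
  refine NormedSpace.norm_le_dual_bound 𝕜 _ hM0 fun φ => ?_
  exact (g ⟨S, c, hc⟩).le_of_opNorm_le (hM _) φ

namespace UnconditionallyBounded

variable {x : ℕ → E} {M : ℝ}

theorem nonneg (hx : UnconditionallyBounded 𝕜 x M) : 0 ≤ M := by
  simpa using hx ∅ 0 (by simp)

theorem norm_le (hx : UnconditionallyBounded 𝕜 x M) (i : ℕ) : ‖x i‖ ≤ M := by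
  simpa using hx {i} 1 (by simp)

theorem comp_injective (hx : UnconditionallyBounded 𝕜 x M) {s : ℕ → ℕ}
    (hs : Function.Injective s) : UnconditionallyBounded 𝕜 (x ∘ s) M := by
  classical
  intro S c hc
  have h := hx (S.image s) (fun j => c (Function.invFun s j)) fun _ => hc _
  rw [Finset.sum_image hs.injOn] at h
  simpa [Function.leftInverse_invFun hs _] using h

theorem norm_sum_smul_le (hx : UnconditionallyBounded 𝕜 x M) (S : Finset ℕ) (a : ℕ → 𝕜) {r : ℝ}
    (hr : 0 ≤ r) (ha : ∀ i ∈ S, ‖a i‖ ≤ r) : ‖∑ i ∈ S, a i • x i‖ ≤ r * M := by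
  classical
  rcases hr.eq_or_lt with rfl | hr
  · rw [Finset.sum_eq_zero fun i hi => by rw [norm_le_zero_iff.1 (ha i hi), zero_smul]]
    simp
  have h := hx S (fun i => if i ∈ S then (r : 𝕜)⁻¹ * a i else 0) fun i => by
    split_ifs with hi
    · rw [norm_mul, norm_inv, RCLike.norm_ofReal, abs_of_pos hr, inv_mul_le_iff₀ hr, mul_one]
      exact ha i hi
    · simp
  have hr' : (r : 𝕜) ≠ 0 := by exact_mod_cast hr.ne'
  have e : ∑ i ∈ S, a i • x i
      = (r : 𝕜) • ∑ i ∈ S, (if i ∈ S then (r : 𝕜)⁻¹ * a i else 0) • x i := by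
    rw [Finset.smul_sum]
    refine Finset.sum_congr rfl fun i hi => ?_
    rw [if_pos hi, smul_smul, mul_inv_cancel_left₀ hr']
  rw [e, norm_smul, RCLike.norm_ofReal, abs_of_pos hr]
  exact mul_le_mul_of_nonneg_left h hr.le

theorem sum_norm_apply_le (hx : UnconditionallyBounded 𝕜 x M) (φ : E →L[𝕜] 𝕜) (S : Finset ℕ) :
    ∑ i ∈ S, ‖φ (x i)‖ ≤ ‖φ‖ * M := by
  let c : ℕ → 𝕜 := fun i => (‖φ (x i)‖ : 𝕜)⁻¹ * (starRingEnd 𝕜) (φ (x i))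
  have hc : ∀ i, ‖c i‖ ≤ 1 := fun i => by
    simp only [c, norm_mul, norm_inv, RCLike.norm_ofReal, abs_norm, RCLike.norm_conj]
    exact inv_mul_le_one
  have hcφ : ∀ i, c i * φ (x i) = (‖φ (x i)‖ : 𝕜) := fun i => by
    simp only [c, mul_assoc, RCLike.conj_mul]
    by_cases h : (‖φ (x i)‖ : 𝕜) = 0
    · simp [h]
    · field_simp
  have e : φ (∑ i ∈ S, c i • x i) = ((∑ i ∈ S, ‖φ (x i)‖ : ℝ) : 𝕜) := by
    simp [hcφ]
  have h := φ.le_opNorm_of_le (hx S c hc)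
  rwa [e, RCLike.norm_ofReal, abs_of_nonneg (Finset.sum_nonneg fun _ _ => norm_nonneg _)] at h

theorem weaklyUnconditionallyCauchy (hx : UnconditionallyBounded 𝕜 x M) :
    WeaklyUnconditionallyCauchy 𝕜 x := fun φ =>
  summable_of_sum_le (fun _ => norm_nonneg _) (hx.sum_norm_apply_le φ)

theorem summable_smul [CompleteSpace E] (hx : UnconditionallyBounded 𝕜 x M) {a : ℕ → 𝕜}
    (ha : Tendsto a atTop (𝓝 0)) : Summable fun i => a i • x i := by
  rw [summable_iff_vanishing_norm]
  intro ε hε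
  have hM := hx.nonneg
  have hr : 0 < ε / (M + 1) := by positivity
  obtain ⟨N, hN⟩ := Metric.tendsto_atTop.1 ha _ hr
  refine ⟨Finset.range N, fun t ht => ?_⟩
  refine (hx.norm_sum_smul_le t a hr.le fun i hi => ?_).trans_lt ?_
  · have : N ≤ i := by simpa using Finset.disjoint_left.1 ht hi
    simpa using (hN i this).le
  · rw [div_mul_eq_mul_div, div_lt_iff₀ (by positivity)]
    nlinarith

/-- Multipliers tending pointwise to zero turn an unconditionally bounded sequence into a bounded
operator. -/
theorem exists_hasSum_smul [CompleteSpace F] {y : ℕ → F} (hy : UnconditionallyBounded 𝕜 y M)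
    (ψ : ℕ → E →L[𝕜] 𝕜) {C : ℝ} (hC : ∀ j, ‖ψ j‖ ≤ C)
    (hψ : ∀ v, Tendsto (fun j => ψ j v) atTop (𝓝 0)) :
    ∃ T : E →L[𝕜] F, ∀ v, HasSum (fun j => ψ j v • y j) (T v) := by
  have hs := fun v => hy.summable_smul (hψ v)
  have hC0 : 0 ≤ C := (norm_nonneg _).trans (hC 0)
  let L : E →ₗ[𝕜] F :=
    { toFun := fun v => ∑' j, ψ j v • y j
      map_add' := fun v w => by
        simp only [map_add, add_smul]
        exact (hs v).tsum_add (hs w)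
      map_smul' := fun c v => by
        simp only [map_smul, smul_eq_mul, mul_smul, RingHom.id_apply]
        exact (hs v).tsum_const_smul c }
  refine ⟨L.mkContinuous (C * M) fun v => ?_, fun v => (hs v).hasSum⟩
  refine le_of_tendsto (hs v).hasSum.norm (Eventually.of_forall fun S => ?_)
  rw [mul_right_comm]
  exact hy.norm_sum_smul_le S _ (by positivity) fun j _ => (ψ j).le_of_opNorm_le (hC j) v

end UnconditionallyBounded

/-! ### Choosing signs -/

/-- The left-hand vector is the average of its two versions with sign `±1` on one index, as the
cross terms cancel; hence one version is at least as large. Indices are treated one at a time. -/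
theorem exists_signs_norm_sum_apply_le (S : Finset ℕ) (V : ℕ → E →L[𝕜] F) (u : ℕ → E)
    (v : E →L[𝕜] F) (w : E) :
    ∃ ε : ℕ → 𝕜, (∀ i, ‖ε i‖ = 1) ∧
      ‖v w + ∑ i ∈ S, V i (u i)‖ ≤ ‖(v + ∑ i ∈ S, ε i • V i) (w + ∑ i ∈ S, ε i • u i)‖ := by
  classical
  induction S using Finset.induction_on generalizing v w with
  | empty => exact ⟨1, by simp, by simp⟩
  | insert a S ha ih =>
    have key : ∃ e : 𝕜, ‖e‖ = 1 ∧ ‖v w + ∑ i ∈ insert a S, V i (u i)‖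
        ≤ ‖(v + e • V a) (w + e • u a) + ∑ i ∈ S, V i (u i)‖ := by
      by_contra! h
      have h1 := h 1 (by simp)
      have h2 := h (-1) (by simp)
      have e : (2 : 𝕜) • (v w + ∑ i ∈ insert a S, V i (u i))
          = ((v + (1 : 𝕜) • V a) (w + (1 : 𝕜) • u a) + ∑ i ∈ S, V i (u i))
            + ((v + (-1 : 𝕜) • V a) (w + (-1 : 𝕜) • u a) + ∑ i ∈ S, V i (u i)) := by
        rw [Finset.sum_insert ha, two_smul]
        simp only [one_smul, neg_smul, add_apply, neg_apply, map_add, map_neg]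
        abel
      have h3 := congrArg norm e
      rw [norm_smul, RCLike.norm_ofNat] at h3
      have h4 := h3.le.trans (norm_add_le _ _)
      linarith
    obtain ⟨e, he, hle⟩ := key
    obtain ⟨ε, hε, h⟩ := ih (v + e • V a) (w + e • u a)
    refine ⟨Function.update ε a e, fun i => ?_, hle.trans (h.trans_eq ?_)⟩
    · rcases eq_or_ne i a with rfl | hi
      · simpa using he
      · simpa [hi] using hε i
    · have hV : ∑ i ∈ S, Function.update ε a e i • V i = ∑ i ∈ S, ε i • V i :=
        Finset.sum_congr rfl fun i hi => by
          rw [Function.update_of_ne (ne_of_mem_of_not_mem hi ha)]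
      have hu : ∑ i ∈ S, Function.update ε a e i • u i = ∑ i ∈ S, ε i • u i :=
        Finset.sum_congr rfl fun i hi => by
          rw [Function.update_of_ne (ne_of_mem_of_not_mem hi ha)]
      rw [Finset.sum_insert ha, Finset.sum_insert ha, hV, hu, Function.update_self, add_assoc,
        add_assoc]

theorem ContinuousMultilinearMap.exists_signs_norm_sum_family_apply_le (S : Finset ℕ) {m : ℕ}
    (B : ℕ → ContinuousMultilinearMap 𝕜 (fun _ : Fin m => E) F) (x : Fin m → ℕ → E) :
    ∃ (η : ℕ → 𝕜) (ε : Fin m → ℕ → 𝕜), (∀ i, ‖η i‖ = 1) ∧ (∀ l i, ‖ε l i‖ = 1) ∧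
      ‖∑ i ∈ S, B i (fun l => x l i)‖
        ≤ ‖(∑ i ∈ S, η i • B i) (fun l => ∑ i ∈ S, ε l i • x l i)‖ := by
  induction m with
  | zero =>
    refine ⟨1, 1, by simp, by simp, le_of_eq ?_⟩
    simp only [Pi.one_apply, one_smul, sum_apply]
    exact congrArg _ (Finset.sum_congr rfl fun i _ => congrArg _ (Subsingleton.elim _ _))
  | succ m ih =>
    obtain ⟨η, ε, hη, hε, h⟩ := ih (fun i => (B i).curryLeft (x 0 i)) (fun l => x l.succ)
    set z : Fin m → E := fun l => ∑ i ∈ S, ε l i • x l.succ i with hz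
    let ev := ContinuousMultilinearMap.apply 𝕜 (fun _ : Fin m => E) F z
    obtain ⟨θ, hθ, h'⟩ := exists_signs_norm_sum_apply_le (𝕜 := 𝕜) S
      (fun i => η i • ev.comp (B i).curryLeft) (x 0) 0 0
    -- Cross terms cancel only if `B i` and `x 0 i` carry the same new sign, so `θ i` multiplies the
    -- earlier weight `η i`.
    refine ⟨fun i => θ i * η i, Fin.cons θ ε, fun i => by simp [hθ, hη], fun l i => ?_, ?_⟩
    · refine Fin.cases ?_ (fun l => ?_) l
      · simpa using hθ i
      · simpa using hε l i
    · have e1 : ∑ i ∈ S, B i (fun l => x l i)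
          = ∑ i ∈ S, (B i).curryLeft (x 0 i) (fun l => x l.succ i) := by
        refine Finset.sum_congr rfl fun i _ => ?_
        rw [ContinuousMultilinearMap.curryLeft_apply]
        congr 1
        ext l
        refine Fin.cases ?_ (fun l => ?_) l <;> simp
      have e2 : (fun l : Fin (m + 1) =>
          ∑ i ∈ S, (Fin.cons θ ε : Fin (m + 1) → ℕ → 𝕜) l i • x l i)
          = Fin.cons (∑ i ∈ S, θ i • x 0 i) z := by
        ext l
        refine Fin.cases ?_ (fun l => ?_) l <;> simp [hz]
      rw [e1, e2]
      refine h.trans ?_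
      rw [zero_add, zero_add] at h'
      generalize ∑ i ∈ S, θ i • x 0 i = w at h' ⊢
      simpa [ev, sum_apply, mul_smul] using h'

/-- Feeding `x 0 i` to `A` gives a family of `m`-linear maps; by linearity its weights `η` become
the signs of slot `0`. -/
theorem ContinuousMultilinearMap.exists_signs_norm_sum_apply_le (S : Finset ℕ) {m : ℕ}
    (A : ContinuousMultilinearMap 𝕜 (fun _ : Fin (m + 1) => E) F) (x : Fin (m + 1) → ℕ → E) :
    ∃ ε : Fin (m + 1) → ℕ → 𝕜, (∀ l i, ‖ε l i‖ = 1) ∧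
      ‖∑ i ∈ S, A (fun l => x l i)‖ ≤ ‖A (fun l => ∑ i ∈ S, ε l i • x l i)‖ := by
  obtain ⟨η, ε, hη, hε, h⟩ := ContinuousMultilinearMap.exists_signs_norm_sum_family_apply_le S
    (fun i => A.curryLeft (x 0 i)) (fun l => x l.succ)
  refine ⟨Fin.cons η ε, fun l i => ?_, ?_⟩
  · refine Fin.cases ?_ (fun l => ?_) l
    · simpa using hη i
    · simpa using hε l i
  have e1 : ∑ i ∈ S, A (fun l => x l i)
      = ∑ i ∈ S, A.curryLeft (x 0 i) (fun l => x l.succ i) := by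
    refine Finset.sum_congr rfl fun i _ => ?_
    rw [ContinuousMultilinearMap.curryLeft_apply]
    congr 1
    ext l
    refine Fin.cases ?_ (fun l => ?_) l <;> simp
  have e2 : (fun l : Fin (m + 1) =>
      ∑ i ∈ S, (Fin.cons η ε : Fin (m + 1) → ℕ → 𝕜) l i • x l i)
      = Fin.cons (∑ i ∈ S, η i • x 0 i) (fun l => ∑ i ∈ S, ε l i • x l.succ i) := by
    ext l
    refine Fin.cases ?_ (fun l => ?_) l <;> simp
  rw [e1, e2, ← ContinuousMultilinearMap.curryLeft_apply]
  have e3 : A.curryLeft (∑ i ∈ S, η i • x 0 i) = ∑ i ∈ S, η i • A.curryLeft (x 0 i) := by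
    simp only [_root_.map_sum, _root_.map_smul]
  rwa [e3]

theorem UnconditionallyBounded.multilinear {m : ℕ}
    (A : ContinuousMultilinearMap 𝕜 (fun _ : Fin (m + 1) => E) F) {x : Fin (m + 1) → ℕ → E}
    {M : Fin (m + 1) → ℝ} (hx : ∀ l, UnconditionallyBounded 𝕜 (x l) (M l)) :
    UnconditionallyBounded 𝕜 (fun i => A fun l => x l i) (‖A‖ * ∏ l, M l) := by
  intro S c hc
  -- The scalar `c i` is absorbed into the first slot.
  let d : Fin (m + 1) → ℕ → 𝕜 := Fin.cons c 1
  have hd : ∀ l i, ‖d l i‖ ≤ 1 := fun l i => by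
    refine Fin.cases ?_ (fun l => ?_) l
    · simpa [d] using hc i
    · simp [d]
  have e : ∀ i, c i • A (fun l => x l i) = A (fun l => d l i • x l i) := fun i => by
    rw [A.map_smul_univ, Fin.prod_univ_succ]
    simp [d]
  obtain ⟨ε, hε, h⟩ := A.exists_signs_norm_sum_apply_le S (fun l i => d l i • x l i)
  simp only [e]
  refine h.trans (A.le_opNorm_mul_prod_of_le fun l => ?_)
  simp only [smul_smul]
  exact hx l S (fun i => ε l i * d l i) fun i => by simpa [hε] using hd l i

/-! ### Disjointification -/

/-- Rosenthal's disjointification lemma. -/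
theorem exists_injective_forall_sum_offDiag_le {a : ℕ → ℕ → ℝ} (ha : ∀ i j, 0 ≤ a i j) {C ε : ℝ}
    (hε : 0 < ε) (hC : ∀ i (S : Finset ℕ), ∑ j ∈ S, a i j ≤ C) :
    ∃ s : ℕ → ℕ, Function.Injective s ∧
      ∀ i (S : Finset ℕ), i ∉ S → ∑ j ∈ S, a (s i) (s j) ≤ ε := by
  classical
  obtain ⟨m, hm⟩ := exists_nat_ge (C / ε)
  have hm' : ∀ i (S : Finset ℕ), ∑ j ∈ S, a i j ≤ m * ε := fun i S =>
    (hC i S).trans ((div_le_iff₀ hε).1 hm)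
  clear hm hC
  induction m generalizing a with
  | zero =>
    exact ⟨id, Function.injective_id, fun i S _ => (hm' i S).trans (by simpa using hε.le)⟩
  | succ m ih =>
    -- Pairing splits `ℕ` into infinitely many infinite classes. If none works, each class `p` has a
    -- row `i p` with off-diagonal mass above `ε` inside the class; keeping only one index `t p` per
    -- class discards that mass, so the row bound drops by `ε`.
    by_cases h : ∃ p, ∀ i (S : Finset ℕ), i ∉ S →
        ∑ j ∈ S, a (Nat.pair p i) (Nat.pair p j) ≤ ε
    · obtain ⟨p, hp⟩ := h
      exact ⟨fun q => Nat.pair p q, fun q r hqr => (Nat.pair_eq_pair.1 hqr).2, hp⟩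
    push Not at h
    choose i S hiS hlt using h
    let t : ℕ → ℕ := fun p => Nat.pair p (i p)
    have ht : Function.Injective t := fun p q hpq => (Nat.pair_eq_pair.1 hpq).1
    obtain ⟨s, hs, hs'⟩ := ih (a := fun p q => a (t p) (t q)) (fun _ _ => ha _ _) fun p R => by
      have hdisj : Disjoint (R.image t) ((S p).image (Nat.pair p)) := by
        rw [Finset.disjoint_left]
        intro n hn hn'
        obtain ⟨q, _, rfl⟩ := Finset.mem_image.1 hn
        obtain ⟨r, hr, hqr⟩ := Finset.mem_image.1 hn'
        obtain ⟨rfl, rfl⟩ := Nat.pair_eq_pair.1 hqr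
        exact hiS _ hr
      have h := hm' (t p) (R.image t ∪ (S p).image (Nat.pair p))
      rw [Finset.sum_union hdisj, Finset.sum_image ht.injOn,
        Finset.sum_image fun q _ r _ hqr => (Nat.pair_eq_pair.1 hqr).2] at h
      have h' := hlt p
      push_cast at h
      simp only [t] at h h' ⊢
      linarith
    exact ⟨t ∘ s, ht.comp hs, hs'⟩

/-! ### From operators to multilinear maps -/

theorem UnconditionallyConvergent.tendsto_zero {y : ℕ → F} (hy : UnconditionallyConvergent y) :
    Tendsto y atTop (𝓝 0) := by
  obtain ⟨s, hs⟩ := hy id strictMono_id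
  have h := (hs.comp (tendsto_add_atTop_nat 1)).sub hs
  simpa [Function.comp_def, Finset.sum_range_succ] using h

theorem Summable.unconditionallyConvergent [CompleteSpace F] {y : ℕ → F} (hy : Summable y) :
    UnconditionallyConvergent y := fun _ hσ =>
  ⟨_, (hy.comp_injective hσ.injective).hasSum.tendsto_sum_nat⟩

/-- If bounded operators `V n` tend pointwise to zero and `V n (u n) = y n` is bounded below, for
unconditionally bounded `u` and `y`, then some bounded operator fails to be unconditionally
converging. -/
theorem false_of_pointwise_tendsto_zero [CompleteSpace F]
    (hEF : ∀ T : E →L[𝕜] F, UnconditionallyConverging 𝕜 (fun x => T x))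
    {u : ℕ → E} {Mu : ℝ} (hu : UnconditionallyBounded 𝕜 u Mu)
    {y : ℕ → F} {My : ℝ} (hy : UnconditionallyBounded 𝕜 y My)
    {δ : ℝ} (hδ : 0 < δ) (hyδ : ∀ n, δ ≤ ‖y n‖)
    (V : ℕ → E →L[𝕜] F) {C : ℝ} (hVC : ∀ n, ‖V n‖ ≤ C) (hVu : ∀ n, V n (u n) = y n)
    (hV : ∀ v, Tendsto (fun n => V n v) atTop (𝓝 0)) : False := by
  classical
  have hC0 : 0 ≤ C := (norm_nonneg _).trans (hVC 0)
  have hMu := hu.nonneg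
  choose φ hφ1 hφy using fun n => exists_dual_vector'' 𝕜 (y n)
  have hD : 0 < C * Mu + 1 := by positivity
  -- Coefficients of `T (u (s i))` are at most `C * Mu`, so this choice keeps the off-diagonal part
  -- below `δ ^ 2 / 2`, against a diagonal term `‖y (s i)‖ ^ 2 ≥ δ ^ 2`.
  obtain ⟨s, hs, hsum⟩ := exists_injective_forall_sum_offDiag_le
    (a := fun i j => ‖φ i (y j)‖) (fun _ _ => norm_nonneg _) (C := My)
    (ε := δ ^ 2 / 2 / (C * Mu + 1)) (by positivity) fun i S =>
      (hy.sum_norm_apply_le (φ i) S).trans (mul_le_of_le_one_left hy.nonneg (hφ1 i))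
  let ψ : ℕ → E →L[𝕜] 𝕜 := fun j => (φ (s j)).comp (V (s j))
  have hψ : ∀ j v, ‖ψ j v‖ ≤ ‖V (s j) v‖ := fun j v =>
    ((φ (s j)).le_of_opNorm_le (hφ1 _) (V (s j) v)).trans_eq (one_mul _)
  have hψC : ∀ j, ‖ψ j‖ ≤ C := fun j =>
    (ψ j).opNorm_le_bound hC0 fun v => (hψ j v).trans ((V (s j)).le_of_opNorm_le (hVC _) v)
  obtain ⟨T, hT⟩ := (hy.comp_injective hs).exists_hasSum_smul ψ hψC fun v =>
    squeeze_zero_norm (fun j => hψ j v)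
      (by simpa using ((hV v).comp hs.nat_tendsto_atTop).norm)
  have hlim := (hEF T _ (hu.comp_injective hs).weaklyUnconditionallyCauchy).tendsto_zero
  have hlow : ∀ i, δ ^ 2 / 2 ≤ ‖T (u (s i))‖ := fun i => by
    have hφT : HasSum (fun j => ψ j (u (s i)) * φ (s i) (y (s j))) (φ (s i) (T (u (s i)))) := by
      simpa using (φ (s i)).hasSum (hT (u (s i)))
    have hdiag : ψ i (u (s i)) * φ (s i) (y (s i)) = ((‖y (s i)‖ ^ 2 : ℝ) : 𝕜) := by
      simp [ψ, hVu, hφy, sq]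
    have hoff : ‖φ (s i) (T (u (s i))) - ((‖y (s i)‖ ^ 2 : ℝ) : 𝕜)‖ ≤ δ ^ 2 / 2 := by
      refine le_of_tendsto (hφT.sub_const _).norm ?_
      filter_upwards [eventually_ge_atTop {i}] with S hS
      rw [Finset.singleton_subset_iff.1 hS |> Finset.add_sum_erase S _ |>.symm, hdiag,
        add_sub_cancel_left]
      calc ‖∑ j ∈ S.erase i, ψ j (u (s i)) * φ (s i) (y (s j))‖
          ≤ ∑ j ∈ S.erase i, (C * Mu + 1) * ‖φ (s i) (y (s j))‖ := by
            refine norm_sum_le_of_le _ fun j _ => ?_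
            rw [norm_mul]
            gcongr
            have h := (ψ j).le_of_opNorm_le_of_le (hψC j) (hu.norm_le (s i))
            linarith
        _ ≤ (C * Mu + 1) * (δ ^ 2 / 2 / (C * Mu + 1)) := by
            rw [← Finset.mul_sum]
            exact mul_le_mul_of_nonneg_left (hsum i _ (Finset.notMem_erase i S)) hD.le
        _ = δ ^ 2 / 2 := mul_div_cancel₀ _ hD.ne'
    have h1 : ‖φ (s i) (T (u (s i)))‖ ≤ ‖T (u (s i))‖ := by
      simpa using (φ (s i)).le_of_opNorm_le (hφ1 _) (T (u (s i)))
    have h2 : ‖((‖y (s i)‖ ^ 2 : ℝ) : 𝕜)‖ = ‖y (s i)‖ ^ 2 := by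
      rw [RCLike.norm_ofReal, abs_of_nonneg (by positivity)]
    have h3 := norm_sub_norm_le ((‖y (s i)‖ ^ 2 : ℝ) : 𝕜) (φ (s i) (T (u (s i))))
    rw [norm_sub_rev, h2] at h3
    have h4 : δ ^ 2 ≤ ‖y (s i)‖ ^ 2 := pow_le_pow_left₀ hδ.le (hyδ _) 2
    linarith
  have h0 := ge_of_tendsto' hlim.norm hlow
  rw [norm_zero] at h0
  have : 0 < δ ^ 2 / 2 := by positivity
  linarith

theorem ContinuousMultilinearMap.tendsto_zero_of_unconditionallyBounded [CompleteSpace F]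
    (hEF : ∀ T : E →L[𝕜] F, UnconditionallyConverging 𝕜 (fun x => T x)) {m : ℕ}
    (A : ContinuousMultilinearMap 𝕜 (fun _ : Fin (m + 1) => E) F) {x : Fin (m + 1) → ℕ → E}
    {M : Fin (m + 1) → ℝ} (hx : ∀ l, UnconditionallyBounded 𝕜 (x l) (M l)) :
    Tendsto (fun n => A fun l => x l n) atTop (𝓝 0) := by
  induction m with
  | zero =>
    have h := (hEF (A.toContinuousLinearMap 0 0) _
      (hx 0).weaklyUnconditionallyCauchy).tendsto_zero
    refine h.congr fun n => ?_
    change A (Function.update 0 0 (x 0 n)) = A fun l => x l n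
    congr 1
    ext l
    rw [Fin.fin_one_eq_zero l]
    exact Function.update_self ..
  | succ m ih =>
    by_contra hA
    obtain ⟨δ, hδ, hfreq⟩ : ∃ δ > 0, ∀ N, ∃ n ≥ N, δ ≤ ‖A fun l => x l n‖ := by
      simpa [Metric.tendsto_atTop] using hA
    obtain ⟨s, hs, hsδ⟩ := extraction_of_frequently_atTop (frequently_atTop.2 hfreq)
    have hx' := fun l => (hx l).comp_injective hs.injective
    let z : ℕ → Fin (m + 1) → E := fun n l => x l.succ (s n)
    refine false_of_pointwise_tendsto_zero hEF (hx' 0) (UnconditionallyBounded.multilinear A hx')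
      hδ hsδ
      (fun n => (ContinuousMultilinearMap.apply 𝕜 (fun _ : Fin (m + 1) => E) F (z n)).comp
        A.curryLeft) (C := ‖A‖ * ∏ l : Fin (m + 1), M l.succ) (fun n => ?_) (fun n => ?_)
      fun v => ?_
    · have hP : 0 ≤ ∏ l : Fin (m + 1), M l.succ := Finset.prod_nonneg fun l _ => (hx _).nonneg
      refine ContinuousLinearMap.opNorm_le_bound _ (by positivity) fun v => ?_
      calc ‖A.curryLeft v (z n)‖ ≤ ‖A.curryLeft v‖ * ∏ l : Fin (m + 1), M l.succ :=
            (A.curryLeft v).le_opNorm_mul_prod_of_le fun l => (hx _).norm_le _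
        _ ≤ (‖A‖ * ‖v‖) * ∏ l : Fin (m + 1), M l.succ := by
            gcongr
            exact A.curryLeft.le_of_opNorm_le A.curryLeft_norm.le v
        _ = _ := mul_right_comm _ _ _
    · change A (Fin.cons (x 0 (s n)) (z n)) = A fun l => x l (s n)
      congr 1
      ext l
      refine Fin.cases ?_ (fun l => ?_) l <;> simp [z]
    -- Pointwise convergence to zero is the induction hypothesis with the first argument frozen at
    -- `v`.
    · exact (ih (A.curryLeft v) fun l => hx' l.succ)

theorem WeaklyUnconditionallyCauchy.blocks {x : ℕ → E} (hx : WeaklyUnconditionallyCauchy 𝕜 x)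
    {f : ℕ → Finset ℕ} (hf : Pairwise (Function.onFun Disjoint f)) (c : ℕ → ℕ → 𝕜)
    (hc : ∀ j i, ‖c j i‖ ≤ 1) :
    WeaklyUnconditionallyCauchy 𝕜 fun j => ∑ i ∈ f j, c j i • x i := by
  classical
  intro φ
  refine summable_of_sum_le (c := ∑' i, ‖φ (x i)‖) (fun _ => norm_nonneg _) fun S => ?_
  calc ∑ j ∈ S, ‖φ (∑ i ∈ f j, c j i • x i)‖ ≤ ∑ j ∈ S, ∑ i ∈ f j, ‖φ (x i)‖ := by
        refine Finset.sum_le_sum fun j _ => ?_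
        rw [map_sum]
        refine norm_sum_le_of_le _ fun i _ => ?_
        rw [map_smul, norm_smul]
        exact mul_le_of_le_one_left (norm_nonneg _) (hc j i)
    _ = ∑ i ∈ S.biUnion f, ‖φ (x i)‖ := (Finset.sum_biUnion fun i _ j _ hij => hf hij).symm
    _ ≤ _ := (hx φ).sum_le_tsum _ fun _ _ => norm_nonneg _

end

/-! ### Main theorem -/

theorem mainTheorem1 {𝕜 E F : Type*} [RCLike 𝕜]
    [NormedAddCommGroup E] [NormedSpace 𝕜 E] [CompleteSpace E]
    [NormedAddCommGroup F] [NormedSpace 𝕜 F] [CompleteSpace F]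
    (hEF : ∀ T : E →L[𝕜] F, UnconditionallyConverging 𝕜 (fun x => T x))
    (k : ℕ) (hk : 1 ≤ k) (P : E → F) (hP : IsHomogeneousPolynomial 𝕜 k P) :
    UnconditionallyConverging 𝕜 P := by
  obtain ⟨m, rfl⟩ := Nat.exists_eq_add_of_le' hk
  obtain ⟨A, hA⟩ := hP
  intro x hx
  refine Summable.unconditionallyConvergent ?_
  by_contra hns
  rw [summable_iff_vanishing_norm] at hns
  push Not at hns
  obtain ⟨δ, hδ, hblock⟩ := hns
  obtain ⟨f, hfδ, hf⟩ := exists_seq_of_forall_finset_exists'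
    (fun t : Finset ℕ => δ ≤ ‖∑ i ∈ t, P (x i)‖) Disjoint fun s _ => by
      -- `s.sup id` is the union of the blocks already chosen.
      obtain ⟨t, ht, htδ⟩ := hblock (s.sup id)
      exact ⟨t, htδ, fun r hr => (ht.mono_right (Finset.le_sup (f := id) hr)).symm⟩
  choose ε hε hle using fun j => A.exists_signs_norm_sum_apply_le (f j) fun _ => x
  choose M hM using fun l => (hx.blocks hf (fun j => ε j l)
    fun j i => (hε j l i).le).exists_unconditionallyBounded
  have hlim := A.tendsto_zero_of_unconditionallyBounded hEF hM
  have h0 := ge_of_tendsto' hlim.norm fun j => (hfδ j).trans (by simpa only [hA] using hle j)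
  rw [norm_zero] at h0
  exact hδ.not_ge h0
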